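/- Let $R$ be an associative ring with unit. Let $\mathcal F_1$ (resp. $\mathcal P_1$) be the class of right $R$-modules of flat (resp. projective) dimension at most $1$, and let $\varinjlim \mathcal P_1$ be the class of right $R$-modules that are direct limits of direct systems of modules in $\mathcal P_1$. Call $R$ right $\mathcal F_1^{\mathrm{fp}}$-coherent if every finitely generated flat submodule of a free right $R$-module is finitely presented. If every module in $\mathcal F_1$ belongs to $\varinjlim \mathcal P_1$ (in particular, if $\varinjlim \mathcal P_1=\mathcal F_1$), then $R$ is right $\mathcal F_1^{\mathrm{fp}}$-coherent. -/

import Mathlib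

open CategoryTheory MulOpposite
open scoped TensorProduct

universe u

/-! Right modules over `R` are modules over the opposite ring `Rᵐᵒᵖ`: `op r • m` is `m · r`. -/

namespace RightModule

section Tensor

variable {R : Type u} [Ring R]

/-- The subgroup of `M ⊗ N` (tensor product over `ℤ`) generated by the elements
`(m · r) ⊗ n - m ⊗ (r · n)`. -/
def balancingRelations (M : Type u) [AddCommGroup M] [Module Rᵐᵒᵖ M]
    (A : Type u) [AddCommGroup A] [Module R A] : AddSubgroup (M ⊗[ℤ] A) :=
  AddSubgroup.closure
    {t | ∃ (m : M) (r : R) (a : A), t = (op r • m) ⊗ₜ[ℤ] a - m ⊗ₜ[ℤ] (r • a)}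

variable (R) in
/-- The tensor product `M ⊗_R A` of a right module `M` and a left module `A`, an abelian group. -/
abbrev Tensor (M : Type u) [AddCommGroup M] [Module Rᵐᵒᵖ M]
    (A : Type u) [AddCommGroup A] [Module R A] : Type u :=
  (M ⊗[ℤ] A) ⧸ balancingRelations (R := R) M A

theorem balancingRelations_le_comap (M : Type u) [AddCommGroup M] [Module Rᵐᵒᵖ M]
    {A B : Type u} [AddCommGroup A] [Module R A] [AddCommGroup B] [Module R B] (f : A →ₗ[R] B) :
    balancingRelations (R := R) M A ≤ (balancingRelations (R := R) M B).comap
      (LinearMap.lTensor M f.toAddMonoidHom.toIntLinearMap).toAddMonoidHom := by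
  refine (AddSubgroup.closure_le _).2 ?_
  rintro _ ⟨m, r, a, rfl⟩
  refine AddSubgroup.subset_closure ⟨m, r, f a, ?_⟩
  simp

/-- The homomorphism `M ⊗_R f : M ⊗_R A → M ⊗_R B` induced by a map `f` of left modules. -/
def Tensor.map (M : Type u) [AddCommGroup M] [Module Rᵐᵒᵖ M]
    {A B : Type u} [AddCommGroup A] [Module R A] [AddCommGroup B] [Module R B] (f : A →ₗ[R] B) :
    Tensor R M A →+ Tensor R M B :=
  QuotientAddGroup.map _ _ (LinearMap.lTensor M f.toAddMonoidHom.toIntLinearMap).toAddMonoidHom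
    (balancingRelations_le_comap M f)

end Tensor

variable (R : Type u) [Ring R]

/-- A right module `M` is flat if `M ⊗_R -` preserves injectivity of maps of left modules. -/
def IsFlat (M : Type u) [AddCommGroup M] [Module Rᵐᵒᵖ M] : Prop :=
  ∀ ⦃A B : Type u⦄ [AddCommGroup A] [Module R A] [AddCommGroup B] [Module R B] (f : A →ₗ[R] B),
    Function.Injective f → Function.Injective (Tensor.map M f)

/-- The right module `M` has flat dimension at most `n`: it has a flat resolution
`0 → F_n → ⋯ → F_0 → M → 0` of length `n`. -/
def HasFlatDimensionLE :
    ℕ → ∀ (M : Type u) [AddCommGroup M] [Module Rᵐᵒᵖ M], Prop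
  | 0, M, _, _ => IsFlat R M
  | n + 1, M, _, _ =>
      ∃ (F : Type u) (_ : AddCommGroup F) (_ : Module Rᵐᵒᵖ F) (p : F →ₗ[Rᵐᵒᵖ] M),
        IsFlat R F ∧ Function.Surjective p ∧ HasFlatDimensionLE n (LinearMap.ker p)

/-- The class `ℱ₁` of right modules of flat dimension at most one. -/
def flatDimLEOne : ObjectProperty (ModuleCat.{u} Rᵐᵒᵖ) :=
  fun M => HasFlatDimensionLE R 1 M

/-- The class `𝒫₁` of right modules of projective dimension at most one. -/
def projDimLEOne : ObjectProperty (ModuleCat.{u} Rᵐᵒᵖ) :=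
  fun M => HasProjectiveDimensionLE M 1

variable {R} in
/-- The class `lim→ 𝒞` of right modules that are isomorphic to the direct limit of a direct system
of modules in `𝒞`, indexed by a nonempty directed preordered set. -/
def directLimits (C : ObjectProperty (ModuleCat.{u} Rᵐᵒᵖ)) : ObjectProperty (ModuleCat.{u} Rᵐᵒᵖ) :=
  fun M => ∃ (ι : Type u) (_ : Preorder ι) (_ : DecidableEq ι) (_ : Nonempty ι)
    (_ : IsDirectedOrder ι) (G : ι → ModuleCat.{u} Rᵐᵒᵖ)
    (f : ∀ i j, i ≤ j → (G i →ₗ[Rᵐᵒᵖ] G j)) (_ : DirectedSystem (fun i => G i) (f · · ·)),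
    (∀ i, C (G i)) ∧ Nonempty (Module.DirectLimit (fun i => G i) f ≃ₗ[Rᵐᵒᵖ] M)

/-- `R` is right `ℱ₁^fp`-coherent: every finitely generated flat submodule of a free right module
is finitely presented. -/
def IsF1fpCoherent : Prop :=
  ∀ (L : Type u) [AddCommGroup L] [Module Rᵐᵒᵖ L] [Module.Free Rᵐᵒᵖ L] (N : Submodule Rᵐᵒᵖ L),
    N.FG → IsFlat R N → Module.FinitePresentation Rᵐᵒᵖ N

end RightModule

/-! A finitely generated flat `N` inside a free module already lies in a free module `P` of finite
rank. Then `P ⧸ N` is finitely presented and `0 → N → P → P ⧸ N → 0` shows that it is in `ℱ₁`, hence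
in `lim→ 𝒫₁`. By finite presentation its identity map factors through one term of the direct system
(`Module.DirectLimit.exists_of_comp_eq`), so `P ⧸ N` is a retract of a module in `𝒫₁` and has
projective dimension at most one. Therefore the kernel `N` of `P → P ⧸ N` is projective and, being
finitely generated, finitely presented. -/

namespace Module.DirectLimit

variable {S : Type*} [Ring S] {ι : Type*} [Preorder ι] [DecidableEq ι] [Nonempty ι]
  [IsDirectedOrder ι] {G : ι → Type*} [∀ i, AddCommGroup (G i)] [∀ i, Module S (G i)]
  {f : ∀ i j, i ≤ j → G i →ₗ[S] G j} {M : Type*} [AddCommGroup M] [Module S M]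

/-- A linear map from a finite free module to a direct limit factors through one of the terms. -/
theorem exists_of_comp_eq_of_finite_basis {κ : Type*} [Finite κ] (b : Module.Basis κ S M)
    (φ : M →ₗ[S] DirectLimit G f) : ∃ i, ∃ g : M →ₗ[S] G i, of S ι G f i ∘ₗ g = φ := by
  choose i x hx using fun k => exists_of (φ (b k))
  obtain ⟨j, hj⟩ := Finite.exists_le i
  refine ⟨j, b.constr ℕ fun k => f (i k) j (hj k) (x k), b.ext fun k => ?_⟩
  simp [hx]

variable [DirectedSystem G (f · · ·)]

/-- If the composite of `g : N → G i` with the map to the direct limit kills a finitely generated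
submodule, then `g` already kills it at some later term. -/
theorem exists_le_ker_of_fg {i : ι} (g : M →ₗ[S] G i) {K : Submodule S M} (hK : K.FG)
    (h : K ≤ LinearMap.ker (of S ι G f i ∘ₗ g)) :
    ∃ j, ∃ hij : i ≤ j, K ≤ LinearMap.ker (f i j hij ∘ₗ g) := by
  obtain ⟨s, rfl⟩ := hK
  have hs (x : s) : ∃ j, ∃ hij : i ≤ j, f i j hij (g x) = 0 :=
    of.zero_exact (h (Submodule.subset_span x.2))
  choose j hij hj using hs
  obtain ⟨k, hk⟩ := Finite.exists_le j
  obtain ⟨l, hil, hkl⟩ := exists_ge_ge i k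
  refine ⟨l, hil, Submodule.span_le.2 fun x hx => ?_⟩
  have hjl : j ⟨x, hx⟩ ≤ l := (hk _).trans hkl
  have := DirectedSystem.map_map (f := (f · · ·)) (hij ⟨x, hx⟩) hjl (g x)
  simp only [hj, map_zero] at this
  simpa using this.symm

/-- A linear map from a finitely presented module to a direct limit factors through one of the
terms. -/
theorem exists_of_comp_eq [Module.FinitePresentation S M] (φ : M →ₗ[S] DirectLimit G f) :
    ∃ i, ∃ g : M →ₗ[S] G i, of S ι G f i ∘ₗ g = φ := by
  obtain ⟨n, p, hp⟩ := Module.Finite.exists_fin' S M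
  obtain ⟨i, g, hg⟩ := exists_of_comp_eq_of_finite_basis (Pi.basisFun S (Fin n)) (φ ∘ₗ p)
  -- The finitely many relations of `M` vanish in the limit, hence at some stage `j`; there the lift
  -- descends to `M`.
  obtain ⟨j, hij, hj⟩ := exists_le_ker_of_fg g (Module.FinitePresentation.fg_ker p hp)
    (by rw [hg]; exact LinearMap.ker_le_ker_comp p φ)
  refine ⟨j, (LinearMap.ker p).liftQ _ hj ∘ₗ (p.quotKerEquivOfSurjective hp).symm, ?_⟩
  rw [← LinearMap.cancel_right hp, ← hg]
  ext x
  simp [LinearMap.quotKerEquivOfSurjective_symm_apply]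

end Module.DirectLimit

namespace Module

/-- A finitely generated submodule of a free module is contained in a submodule that is free
of finite rank. -/
theorem Free.exists_finite_free_ge {S L : Type*} [Ring S] [AddCommGroup L] [Module S L]
    [Module.Free S L] {N : Submodule S L} (hN : N.FG) :
    ∃ P : Submodule S L, Module.Free S P ∧ Module.Finite S P ∧ N ≤ P := by
  classical
  let b := Module.Free.chooseBasis S L
  obtain ⟨s, rfl⟩ := hN
  let t := s.biUnion fun x => (b.repr x).support
  refine ⟨Submodule.span S (Set.range fun k : t => b k),
    .of_basis (.span (b.linearIndependent.comp _ Subtype.val_injective)),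
    .span_of_finite S (Set.finite_range _), Submodule.span_le.2 fun x hx => ?_⟩
  have hrange : (Set.range fun k : t => b k) = b '' (t : Set _) := by
    ext; simp
  rw [hrange]
  exact b.mem_span_image.2 (Finset.coe_subset.2 <|
    Finset.subset_biUnion_of_mem (fun x => (b.repr x).support) hx)

/-- The kernel of a surjection from a projective module onto a module of projective dimension at
most one is projective. -/
theorem Projective.ker_of_hasProjectiveDimensionLE_one {S : Type u} [Ring S] {P M : Type u}
    [AddCommGroup P] [Module S P] [Module.Projective S P] [AddCommGroup M] [Module S M]
    (p : P →ₗ[S] M) (hp : Function.Surjective p)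
    (hM : HasProjectiveDimensionLE (ModuleCat.of S M) 1) :
    Module.Projective S (LinearMap.ker p) := by
  have hS := LinearMap.shortExact_shortComplexKer hp
  -- Dimension shift along a projective middle term: the bound `< 2` on the quotient becomes `< 1`
  -- on the kernel.
  have hK := (hS.hasProjectiveDimensionLT_X₃_iff 0
    ((IsProjective.iff_projective P).1 inferInstance)).1 hM
  exact (IsProjective.iff_projective _).2 (projective_iff_hasProjectiveDimensionLT_one.2 hK)

end Module

namespace RightModule

variable {R : Type u} [Ring R]

section Lift

variable {M : Type u} [AddCommGroup M] [Module Rᵐᵒᵖ M] {A : Type u} [AddCommGroup A] [Module R A]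

variable (R) in
/-- The class of `m ⊗ a` in `M ⊗_R A`. -/
def Tensor.tmul (m : M) (a : A) : Tensor R M A :=
  QuotientAddGroup.mk (m ⊗ₜ[ℤ] a)

theorem Tensor.smul_tmul (m : M) (r : R) (a : A) :
    Tensor.tmul R (op r • m) a = Tensor.tmul R m (r • a) := by
  refine (QuotientAddGroup.eq_iff_sub_mem).2 (AddSubgroup.subset_closure ⟨m, r, a, rfl⟩)

theorem Tensor.induction_on {p : Tensor R M A → Prop} (t : Tensor R M A) (zero : p 0)
    (tmul : ∀ m a, p (Tensor.tmul R m a)) (add : ∀ x y, p x → p y → p (x + y)) : p t := by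
  induction t using QuotientAddGroup.induction_on with
  | H t => induction t using TensorProduct.induction_on with
    | zero => exact zero
    | tmul m a => exact tmul m a
    | add x y hx hy => exact add _ _ hx hy

/-- The additive map out of `M ⊗_R A` induced by a balanced biadditive map. -/
def Tensor.lift {C : Type u} [AddCommGroup C] (φ : M →+ A →+ C)
    (hφ : ∀ m (r : R) a, φ (op r • m) a = φ m (r • a)) : Tensor R M A →+ C :=
  QuotientAddGroup.lift _
    (TensorProduct.liftAddHom φ fun n m a => by simp)
    ((AddSubgroup.closure_le _).2 (by rintro _ ⟨m, r, a, rfl⟩; simp [hφ]))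

@[simp]
theorem Tensor.lift_tmul {C : Type u} [AddCommGroup C] (φ : M →+ A →+ C)
    (hφ : ∀ m (r : R) a, φ (op r • m) a = φ m (r • a)) (m : M) (a : A) :
    Tensor.lift (R := R) φ hφ (.tmul R m a) = φ m a :=
  rfl

@[simp]
theorem Tensor.map_tmul {B : Type u} [AddCommGroup B] [Module R B] (f : A →ₗ[R] B) (m : M)
    (a : A) : Tensor.map M f (Tensor.tmul R m a) = Tensor.tmul R m (f a) := by
  simp [Tensor.map, Tensor.tmul]

/-- The additive map `m ↦ m ⊗ a`, additive in `a` as well. -/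
def Tensor.tmulHom : M →+ A →+ Tensor R M A :=
  AddMonoidHom.mk' (fun m => AddMonoidHom.mk' (Tensor.tmul R m) fun a b => by
      simp [Tensor.tmul, TensorProduct.tmul_add])
    fun m n => AddMonoidHom.ext fun a =>
      congr_arg QuotientAddGroup.mk (TensorProduct.add_tmul m n a)

@[simp]
theorem Tensor.tmulHom_apply (m : M) (a : A) :
    Tensor.tmulHom (R := R) m a = Tensor.tmul R m a :=
  rfl

end Lift

/-- Flatness is invariant under isomorphism. -/
theorem IsFlat.of_linearEquiv {M N : Type u} [AddCommGroup M] [Module Rᵐᵒᵖ M] [AddCommGroup N]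
    [Module Rᵐᵒᵖ N] (e : M ≃ₗ[Rᵐᵒᵖ] N) (hM : IsFlat R M) : IsFlat R N := by
  intro A B _ _ _ _ f hf
  have lifted {M N : Type u} [AddCommGroup M] [Module Rᵐᵒᵖ M] [AddCommGroup N] [Module Rᵐᵒᵖ N]
      (e : M →ₗ[Rᵐᵒᵖ] N) (A : Type u) [AddCommGroup A] [Module R A] :
      ∃ ψ : Tensor R M A →+ Tensor R N A, ∀ m a, ψ (.tmul R m a) = .tmul R (e m) a :=
    ⟨Tensor.lift (Tensor.tmulHom.comp e.toAddMonoidHom)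
      fun m r a => (congr_arg (Tensor.tmul R · a) (map_smul e (op r) m)).trans
        (Tensor.smul_tmul (e m) r a), fun m a => Tensor.lift_tmul _ _ m a⟩
  obtain ⟨ψA, hψA⟩ := lifted e.symm.toLinearMap A
  obtain ⟨ψB, hψB⟩ := lifted e.symm.toLinearMap B
  obtain ⟨θA, hθA⟩ := lifted e.toLinearMap A
  have hθψ : Function.LeftInverse θA ψA := fun t => by
    induction t using Tensor.induction_on with
    | zero => simp
    | tmul m a => simp [hψA, hθA]
    | add x y hx hy => simp [hx, hy]
  have hcomm (t) : Tensor.map M f (ψA t) = ψB (Tensor.map N f t) := by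
    induction t using Tensor.induction_on with
    | zero => simp
    | tmul m a => simp [hψA, hψB]
    | add x y hx hy => simp [hx, hy]
  -- By naturality the composite with `ψB` equals `Tensor.map M f ∘ ψA`, a composite of injections.
  refine .of_comp (f := ψB) ?_
  have : ψB ∘ Tensor.map N f = Tensor.map M f ∘ ψA := funext fun t => (hcomm t).symm
  rw [this]
  exact (hM f hf).comp hθψ.injective

section Coord

variable {κ : Type u} {L : Type u} [AddCommGroup L] [Module Rᵐᵒᵖ L]
  (b : Module.Basis κ Rᵐᵒᵖ L)

/-- The coordinates of a tensor in `L ⊗_R A` with respect to a finite basis of `L`. -/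
noncomputable def Tensor.coords (A : Type u) [AddCommGroup A] [Module R A] :
    Tensor R L A →+ (κ → A) :=
  Tensor.lift
    (AddMonoidHom.mk' (fun m => AddMonoidHom.mk' (fun a k => (b.repr m k).unop • a)
        fun x y => by ext; simp)
      fun m n => by ext; simp [add_smul])
    fun m r a => by ext; simp [mul_smul]

@[simp]
theorem Tensor.coords_tmul {A : Type u} [AddCommGroup A] [Module R A] (m : L) (a : A) (k : κ) :
    Tensor.coords b A (.tmul R m a) k = (b.repr m k).unop • a := by
  simp [Tensor.coords]

/-- Expanding `m` in the basis and moving scalars across the tensor sign recovers `m ⊗ a`. Thus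
tensors are determined by their coordinates, on which `Tensor.map` acts entrywise by `f`. -/
theorem Tensor.sum_tmul_coords [Fintype κ] {A : Type u} [AddCommGroup A] [Module R A] (t : Tensor R L A) :
    ∑ k, Tensor.tmulHom (R := R) (b k) (Tensor.coords b A t k) = t := by
  induction t using Tensor.induction_on with
  | zero => simp only [map_zero, Pi.zero_apply, Finset.sum_const_zero]
  | tmul m a =>
    have hk (k : κ) : Tensor.tmulHom (R := R) (b k) ((b.repr m k).unop • a) =
        Tensor.tmulHom (b.repr m k • b k) a :=
      (Tensor.smul_tmul (b k) (b.repr m k).unop a).symm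
    simp only [Tensor.coords_tmul, hk]
    rw [← AddMonoidHom.finsetSum_apply, ← map_sum, b.sum_repr, Tensor.tmulHom_apply]
  | add x y hx hy => simp only [map_add, Pi.add_apply, Finset.sum_add_distrib, hx, hy]

theorem Tensor.coords_map {A B : Type u} [AddCommGroup A] [Module R A] [AddCommGroup B]
    [Module R B] (f : A →ₗ[R] B) (t : Tensor R L A) (k : κ) :
    Tensor.coords b B (Tensor.map L f t) k = f (Tensor.coords b A t k) := by
  induction t using Tensor.induction_on with
  | zero => simp
  | tmul m a => simp
  | add x y hx hy => simp [hx, hy]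

end Coord

/-- Free modules of finite rank are flat. -/
theorem isFlat_of_finite_free (L : Type u) [AddCommGroup L] [Module Rᵐᵒᵖ L]
    [Module.Free Rᵐᵒᵖ L] [Module.Finite Rᵐᵒᵖ L] : IsFlat R L := by
  intro A B _ _ _ _ f hf x y hxy
  let b := Module.Free.chooseBasis Rᵐᵒᵖ L
  rw [← Tensor.sum_tmul_coords b x, ← Tensor.sum_tmul_coords b y]
  refine Finset.sum_congr rfl fun k _ => congr_arg _ ?_
  apply hf
  rw [← Tensor.coords_map, hxy, Tensor.coords_map]

/-- A finitely presented module in `lim→ 𝒫₁` has projective dimension at most one. -/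
theorem hasProjectiveDimensionLE_one_of_directLimits {M : Type u} [AddCommGroup M]
    [Module Rᵐᵒᵖ M] [Module.FinitePresentation Rᵐᵒᵖ M]
    (hM : directLimits (projDimLEOne R) (ModuleCat.of Rᵐᵒᵖ M)) :
    HasProjectiveDimensionLE (ModuleCat.of Rᵐᵒᵖ M) 1 := by
  obtain ⟨ι, _, _, _, _, G, f, _, hG, ⟨e⟩⟩ := hM
  obtain ⟨i, g, hg⟩ := Module.DirectLimit.exists_of_comp_eq (M := M) e.symm.toLinearMap
  -- `hg` factors `e.symm` through `G i`; composing with `e` factors the identity of `M`.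
  have r : Retract (ModuleCat.of Rᵐᵒᵖ M) (G i) :=
    { i := ModuleCat.ofHom g
      r := ModuleCat.ofHom (e.toLinearMap ∘ₗ Module.DirectLimit.of Rᵐᵒᵖ ι (fun i => G i) f i)
      retract := by
        ext x
        exact (congr_arg e (LinearMap.congr_fun hg x)).trans (e.apply_symm_apply x) }
  have : HasProjectiveDimensionLT (G i) 2 := hG i
  exact r.hasProjectiveDimensionLT 2

/-- A finitely generated flat submodule of a finite free module is projective if all modules in
`ℱ₁` belong to `lim→ 𝒫₁`. -/
theorem projective_of_isFlat_of_fg (h : flatDimLEOne R ≤ directLimits (projDimLEOne R))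
    {L : Type u} [AddCommGroup L] [Module Rᵐᵒᵖ L] [Module.Free Rᵐᵒᵖ L] [Module.Finite Rᵐᵒᵖ L]
    {N : Submodule Rᵐᵒᵖ L} (hN : N.FG) (hflat : IsFlat R N) : Module.Projective Rᵐᵒᵖ N := by
  have hker : LinearMap.ker N.mkQ = N := N.ker_mkQ
  have hM : flatDimLEOne R (ModuleCat.of Rᵐᵒᵖ (L ⧸ N)) :=
    ⟨L, inferInstance, inferInstance, N.mkQ, isFlat_of_finite_free L, N.mkQ_surjective,
      hflat.of_linearEquiv (LinearEquiv.ofEq _ _ hker.symm)⟩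
  have : Module.FinitePresentation Rᵐᵒᵖ (L ⧸ N) :=
    Module.finitePresentation_of_free_of_surjective N.mkQ N.mkQ_surjective (hker.symm ▸ hN)
  have := Module.Projective.ker_of_hasProjectiveDimensionLE_one N.mkQ N.mkQ_surjective
    (hasProjectiveDimensionLE_one_of_directLimits (h _ hM))
  exact .of_equiv (LinearEquiv.ofEq _ _ hker)

end RightModule

theorem mainTheorem4 (R : Type u) [Ring R]
    (h : RightModule.flatDimLEOne R ≤ RightModule.directLimits (RightModule.projDimLEOne R)) :
    RightModule.IsF1fpCoherent R := by
  intro L _ _ _ N hN hflat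
  obtain ⟨P, _, _, hNP⟩ := Module.Free.exists_finite_free_ge hN
  let e := Submodule.submoduleOfEquivOfLe hNP
  have : Module.Finite Rᵐᵒᵖ N := .iff_fg.2 hN
  have : Module.Finite Rᵐᵒᵖ (N.submoduleOf P) := .equiv e.symm
  -- `N` is viewed inside `P` because `L` may have infinite rank, and then `L ⧸ N` is not finitely
  -- generated.
  have := RightModule.projective_of_isFlat_of_fg h (Module.Finite.iff_fg.1 this)
    (hflat.of_linearEquiv e.symm)
  have : Module.Projective Rᵐᵒᵖ N := .of_equiv e
  exact Module.finitePresentation_of_projective _ _
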